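/- **Theorem.** Let $E\subset\mathbb R^d$ be compact with its Borel $\sigma$-algebra. Let $\mathcal W_1$ be the set of Borel probability measures on $E$ with finite first moment, with the distance $\mathbb W_1(\mu,\gamma)=\inf_\pi\int\|x-y\|_1\,\pi(dx,dy)$ (infimum over all couplings $\pi$ of $\mu$ and $\gamma$) and the Borel $\sigma$-algebra that it induces. Let $E'\subset\mathbb R^{l}$, let $k:E\times E\to E'$ be bounded and jointly measurable, let $f:E\to E'$ be measurable, and fix $\nu\in\mathcal W_1$. For $x\in E$ put $$\mathcal Q(\nu,x)=\Big\{\mu\in\mathcal W_1 : \mu\ll\nu,\ \int k(x,y)\,\mu(dy)=f(x)\Big\},\qquad H_\nu(\mu)=-\mathrm{KL}(\mu\|\nu)=-\int\log\frac{d\mu}{d\nu}\,d\mu\in[-\infty,0]\quad(\mu\ll\nu).$$ For a bounded measurable $g:E\to(0,\infty)$ let $\Psi_g(\nu)(dy)=g(y)\,\nu(dy)/\int g\,d\nu$ be the Boltzmann–Gibbs transformation of $\nu$. Assume that for every $x\in E$ the set $\mathcal Q(\nu,x)$ contains at least one measure equivalent to $\nu$ (that is, some $\mu\in\mathcal Q(\nu,x)$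 with $\nu\ll\mu$). Then there is a function $\lambda:E\to\mathbb R^{l}$ such that, with $G(x,y)=\exp\langle\lambda(x),k(x,y)\rangle$, for every $x\in E$ the problem $\max_{\mu\in\mathcal Q(\nu,x)}H_\nu(\mu)$ has exactly one maximizer, namely $\mu^*_x=\Psi_{G(x,\cdot)}(\nu)$. Moreover $x\mapsto\mu^*_x$ is measurable as a map $E\to\mathcal W_1$, and $(x,dy)\mapsto\mu^*_x(dy)=\Psi_{G(x,\cdot)}(\nu)(dy)$ is a Markov kernel from $E$ to $E$ (the softmatch kernel $\Psi_G(\nu)$). -/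

import Mathlib

noncomputable section

namespace MaxEntAttention

open MeasureTheory

/-- The set `𝒫₁(E)` of Borel probability measures with finite first moment on a set `E ⊆ ℝᵈ`.
It is a separate structure so that the topology below, induced by the 1-Wasserstein distance,
is the only one that it carries. -/
@[ext]
structure WassersteinOne {d : ℕ} (E : Set (EuclideanSpace ℝ (Fin d))) where
  /-- The underlying measure. -/
  toMeasure : Measure E
  /-- It has total mass one. -/
  isProb : IsProbabilityMeasure toMeasure
  /-- It has a finite first moment. -/
  firstMoment : ∫⁻ x : E, ‖(x : EuclideanSpace ℝ (Fin d))‖ₑ ∂toMeasure < ⊤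

variable {d : ℕ} {E : Set (EuclideanSpace ℝ (Fin d))}

/-- `π` is a coupling of `μ` and `γ`: a measure on `E × E` with marginals `μ` and `γ`. -/
def IsCoupling (π : Measure (E × E)) (μ γ : Measure E) : Prop :=
  π.map Prod.fst = μ ∧ π.map Prod.snd = γ

/-- The transport cost `‖x - y‖₁`. -/
def l1Cost (x y : E) : ℝ :=
  ∑ i : Fin d, |(x : EuclideanSpace ℝ (Fin d)) i - (y : EuclideanSpace ℝ (Fin d)) i|

/-- The 1-Wasserstein distance: the infimum over all couplings of the integral of `‖x - y‖₁`. -/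
def W₁ (μ γ : WassersteinOne E) : ENNReal :=
  ⨅ (π : Measure (E × E)) (_ : IsCoupling π μ.toMeasure γ.toMeasure),
    ∫⁻ p, ENNReal.ofReal (l1Cost p.1 p.2) ∂π

/-- The topology of the 1-Wasserstein distance: `U` is open iff with each of its points it
contains a `W₁`-ball of positive radius around that point. -/
instance : TopologicalSpace (WassersteinOne E) where
  IsOpen U := ∀ μ ∈ U, ∃ ε : ENNReal, 0 < ε ∧ ∀ γ, W₁ μ γ < ε → γ ∈ U
  isOpen_univ := fun _ _ => ⟨1, one_pos, fun _ _ => trivial⟩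
  isOpen_inter := by
    intro U V hU hV μ hμ
    obtain ⟨a, ha, hUa⟩ := hU μ hμ.1
    obtain ⟨b, hb, hVb⟩ := hV μ hμ.2
    exact ⟨min a b, lt_min ha hb, fun γ hγ =>
      ⟨hUa γ (hγ.trans_le (min_le_left _ _)), hVb γ (hγ.trans_le (min_le_right _ _))⟩⟩
  isOpen_sUnion := by
    intro S hS μ hμ
    obtain ⟨U, hUS, hμU⟩ := hμ
    obtain ⟨a, ha, hUa⟩ := hS U hUS μ hμU
    exact ⟨a, ha, fun γ hγ => ⟨U, hUS, hUa γ hγ⟩⟩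

/-- The Borel σ-algebra of the 1-Wasserstein space. -/
instance : MeasurableSpace (WassersteinOne E) := borel _

/-- `μ` encodes the moment vector `v` with respect to `F`: the mean `μ(F)` exists and is `v`. -/
def Encodes {l : ℕ} (μ : Measure E) (F : E → EuclideanSpace ℝ (Fin l))
    (v : EuclideanSpace ℝ (Fin l)) : Prop :=
  Integrable F μ ∧ ∫ y, F y ∂μ = v

/-- The constraint set `𝒬(ν, x)`: all `μ ∈ 𝒲₁` with `μ ≪ ν` and `μ(k(x, ·)) = f(x)`. -/
def constraintSet {l : ℕ} {E' : Set (EuclideanSpace ℝ (Fin l))} (k : E → E → E') (f : E → E')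
    (ν : WassersteinOne E) (x : E) : Set (WassersteinOne E) :=
  {μ | μ.toMeasure ≪ ν.toMeasure ∧
    Encodes μ.toMeasure (fun y => (k x y : EuclideanSpace ℝ (Fin l))) (f x)}

/-- The relative entropy functional `H_ν(μ) = -KL(μ ‖ ν)`, with values in `[-∞, 0]`. -/
def relEntropy (ν μ : WassersteinOne E) : EReal :=
  -((InformationTheory.klDiv μ.toMeasure ν.toMeasure : ENNReal) : EReal)

/-- `μ` maximizes `H_ν` over `𝒬(ν, x)`. -/
def IsMaxEnt {l : ℕ} {E' : Set (EuclideanSpace ℝ (Fin l))} (k : E → E → E') (f : E → E')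
    (ν : WassersteinOne E) (x : E) (μ : WassersteinOne E) : Prop :=
  μ ∈ constraintSet k f ν x ∧ ∀ γ ∈ constraintSet k f ν x, relEntropy ν γ ≤ relEntropy ν μ

/-- The Boltzmann-Gibbs transformation `Ψ_g(ν)(dy) = g(y) ν(dy) / ν(g)`. -/
def boltzmannGibbs (g : E → ℝ) (ν : Measure E) : Measure E :=
  ν.withDensity (fun y => ENNReal.ofReal (g y / ∫ z, g z ∂ν))

/-- The interaction potential `G(x, y) = exp ⟨lam(x), k(x, y)⟩`. -/
def interactionPotential {l : ℕ} {E' : Set (EuclideanSpace ℝ (Fin l))}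
    (lam : E → EuclideanSpace ℝ (Fin l)) (k : E → E → E') (x y : E) : ℝ :=
  Real.exp (inner ℝ (lam x) (k x y : EuclideanSpace ℝ (Fin l)))

end MaxEntAttention

end

/-!
For fixed `x`, centre the moment function: `h y = k x y - f x`. A tilt of `ν` with density
proportional to `exp ⟨v, h⟩` gives `h` mean zero exactly when `v` is a critical point of the
partition function `Z v = ∫ exp ⟨v, h⟩ dν`. A minimizer of `Z` exists
(`exists_forall_partitionFn_le`): feasibility by a measure equivalent to `ν` says that `⟨v, h⟩`
either vanishes almost everywhere, in which case `Z` does not change in the direction `v`, or is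
positive on a set of positive `ν`-measure, in which case `Z` grows linearly in the direction `v`.

The tilt is the unique maximizer by the Pythagorean identity
`KL(γ ‖ ν) = KL(γ ‖ μ*) + KL(μ* ‖ ν)`, valid for every `γ` of finite relative entropy giving `h`
mean zero (`klDiv_tilted_le_and_eq_of_klDiv_le`).

The minimizer of `Z` is not unique when the moments are affinely dependent, and no measurable
choice of it is made. Instead, `∫ φ exp ⟨v, h⟩ dν` at a minimizer `v` is the derivative at `t = 0` of
the value function `t ↦ inf_w ∫ exp (⟨w, h⟩ + t φ) dν` (`tendsto_valueFn_slope`). The infimum may be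
taken over a countable dense set, so the value function, its derivative, and hence the
mass which the tilt gives to each Borel set, are measurable in `x`.

Finally, measurability for the Borel σ-algebra of the Wasserstein distance follows from
measurability of the masses of Borel sets. Two measures giving nearly the same masses to
the cells of a fine finite partition of the compact set `E` have a cheap coupling
(`exists_coupling_lintegral_le`), so a `W₁`-open set is the preimage of an open set in a countable
product of copies of `[0, ∞]` under the map recording the masses of countably many cells
(`exists_isOpen_preimage_eq`).
-/

noncomputable section

namespace MaxEntAttention

open MeasureTheory ProbabilityTheory Filter Topology

/-! ### Integrals of exponentials of bounded functions -/

section Exponential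

variable {α : Type*} [MeasurableSpace α] {ν : Measure α} [IsFiniteMeasure ν]

lemma integrable_of_abs_le {u : α → ℝ} (hu : Measurable u) {C : ℝ} (hC : ∀ y, |u y| ≤ C) :
    Integrable u ν :=
  Integrable.of_bound hu.aestronglyMeasurable C (ae_of_all _ hC)

lemma integrable_exp_of_abs_le {u : α → ℝ} (hu : Measurable u) {C : ℝ} (hC : ∀ y, |u y| ≤ C) :
    Integrable (fun y => Real.exp (u y)) ν :=
  integrable_of_abs_le (C := Real.exp C) (by fun_prop) fun y => by
    rw [Real.abs_exp]
    exact Real.exp_le_exp.2 ((le_abs_self _).trans (hC y))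

lemma hasDerivAt_integral_exp_add_mul {u φ : α → ℝ} (hu : Measurable u) (hφ : Measurable φ)
    {C D : ℝ} (hC : ∀ y, |u y| ≤ C) (hD : ∀ y, |φ y| ≤ D) :
    HasDerivAt (fun t : ℝ => ∫ y, Real.exp (u y + t * φ y) ∂ν)
      (∫ y, φ y * Real.exp (u y) ∂ν) 0 := by
  have h := (hasDerivAt_integral_of_dominated_loc_of_deriv_le (μ := ν) (𝕜 := ℝ)
    (F := fun t y => Real.exp (u y + t * φ y))
    (F' := fun t y => Real.exp (u y + t * φ y) * φ y) (x₀ := 0) (s := Metric.ball 0 1)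
    (bound := fun _ => Real.exp (C + D) * D) (Metric.ball_mem_nhds _ one_pos)
    (Eventually.of_forall fun t => by fun_prop)
    (by simpa using integrable_exp_of_abs_le hu hC) (by fun_prop) ?_ (integrable_const _) ?_).2
  · simpa [mul_comm] using h
  · refine ae_of_all _ fun y t ht => ?_
    rw [norm_mul, Real.norm_eq_abs, Real.norm_eq_abs, Real.abs_exp]
    have ht' : |t| ≤ 1 := by simpa using (Metric.mem_ball.1 ht).le
    have h1 : t * φ y ≤ D := (le_abs_self _).trans <| by
      rw [abs_mul]
      exact (mul_le_of_le_one_left (abs_nonneg _) ht').trans (hD y)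
    gcongr
    · exact (le_abs_self _).trans (hC y)
    · exact hD y
  · refine ae_of_all _ fun y t _ => ?_
    have := ((hasDerivAt_id t).mul_const (φ y)).const_add (u y) |>.exp
    simpa using this

end Exponential

/-! ### The partition function and its minimizers -/

section PartitionFunction

variable {α : Type*} [MeasurableSpace α] {ν : Measure α} [IsFiniteMeasure ν]
  {V : Type*} [NormedAddCommGroup V] [InnerProductSpace ℝ V] [FiniteDimensional ℝ V]
  [MeasurableSpace V] [BorelSpace V] {h : α → V} {C : ℝ}

/-- The partition function `∫ exp (⟨v, h⟩ + t φ) dν` of the moment function `h`, perturbed in the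
direction of the observable `φ`. -/
def partitionFn (ν : Measure α) (h : α → V) (φ : α → ℝ) (t : ℝ) (v : V) : ℝ :=
  ∫ y, Real.exp (inner ℝ v (h y) + t * φ y) ∂ν

omit [MeasurableSpace α] [FiniteDimensional ℝ V] [MeasurableSpace V] [BorelSpace V] in
lemma abs_inner_le_of_norm_le (hC : ∀ y, ‖h y‖ ≤ C) (v : V) (y : α) :
    |inner ℝ v (h y)| ≤ ‖v‖ * C :=
  (abs_real_inner_le_norm _ _).trans (by gcongr; exact hC y)

omit [MeasurableSpace α] [FiniteDimensional ℝ V] [MeasurableSpace V] [BorelSpace V] in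
lemma abs_exponent_le (hC : ∀ y, ‖h y‖ ≤ C) {φ : α → ℝ} {D : ℝ} (hD : ∀ y, |φ y| ≤ D)
    (t : ℝ) (v : V) (y : α) : |inner ℝ v (h y) + t * φ y| ≤ ‖v‖ * C + |t| * D :=
  (abs_add_le _ _).trans (add_le_add (abs_inner_le_of_norm_le hC v y) (by
    rw [abs_mul]; gcongr; exact hD y))

lemma integrable_partitionFn (hh : Measurable h) (hC : ∀ y, ‖h y‖ ≤ C) {φ : α → ℝ}
    (hφ : Measurable φ) {D : ℝ} (hD : ∀ y, |φ y| ≤ D) (t : ℝ) (v : V) :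
    Integrable (fun y => Real.exp (inner ℝ v (h y) + t * φ y)) ν :=
  integrable_exp_of_abs_le (by fun_prop) (abs_exponent_le hC hD t v)

lemma continuous_partitionFn (hh : Measurable h) (hC : ∀ y, ‖h y‖ ≤ C) {φ : α → ℝ}
    (hφ : Measurable φ) {D : ℝ} (hD : ∀ y, |φ y| ≤ D) (t : ℝ) :
    Continuous (partitionFn ν h φ t) := by
  refine continuous_iff_continuousAt.2 fun v => ?_
  refine continuousAt_of_dominated (bound := fun _ => Real.exp ((‖v‖ + 1) * |C| + |t| * D))
    (Eventually.of_forall fun w => by fun_prop) ?_ (integrable_const _)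
    (ae_of_all _ fun y => by fun_prop)
  filter_upwards [Metric.ball_mem_nhds v one_pos] with w hw
  refine ae_of_all _ fun y => ?_
  rw [Real.norm_eq_abs, Real.abs_exp]
  refine Real.exp_le_exp.2 ((le_abs_self _).trans ((abs_exponent_le hC hD t w y).trans ?_))
  have hwv : ‖w‖ ≤ ‖v‖ + 1 := by
    have h1 := norm_le_norm_add_norm_sub' w v
    have h2 : ‖w - v‖ < 1 := by simpa [dist_eq_norm] using hw
    linarith
  have hwC : ‖w‖ * C ≤ (‖v‖ + 1) * |C| :=
    (mul_le_mul_of_nonneg_left (le_abs_self C) (norm_nonneg w)).trans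
      (mul_le_mul_of_nonneg_right hwv (abs_nonneg C))
  linarith

/-- If `h` has mean zero under a measure equivalent to `ν`, the partition function attains its
minimum. It is invariant under translation by the vectors `v` with `⟨v, h⟩ = 0` almost everywhere,
and on their orthogonal complement it grows at least linearly, because
`exp ⟨v, h⟩ ≥ max ⟨v, h⟩ 0`. -/
lemma exists_forall_partitionFn_le (hh : Measurable h) (hC : ∀ y, ‖h y‖ ≤ C)
    {μ : Measure α} [IsFiniteMeasure μ] (hμν : μ ≪ ν) (hνμ : ν ≪ μ) (hmean : ∫ y, h y ∂μ = 0) :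
    ∃ v : V, ∀ w, partitionFn ν h 0 0 v ≤ partitionFn ν h 0 0 w := by
  -- The directions along which the partition function is constant.
  let N : Submodule ℝ V :=
    { carrier := {v | ∀ᵐ y ∂ν, inner ℝ v (h y) = (0 : ℝ)}
      zero_mem' := by simp
      add_mem' := by
        intro a b (ha : ∀ᵐ y ∂ν, _) (hb : ∀ᵐ y ∂ν, _)
        change ∀ᵐ y ∂ν, _
        filter_upwards [ha, hb] with y h1 h2
        rw [inner_add_left, h1, h2, add_zero]
      smul_mem' := by
        intro c a (ha : ∀ᵐ y ∂ν, _)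
        change ∀ᵐ y ∂ν, _
        filter_upwards [ha] with y h1
        rw [real_inner_smul_left, h1, mul_zero] }
  let p : V → ℝ := fun v => ∫ y, max (inner ℝ v (h y)) (0 : ℝ) ∂ν
  have hC' : ∀ y, ‖h y‖ ≤ |C| := fun y => (hC y).trans (le_abs_self _)
  have hbd : ∀ v y, |max (inner ℝ v (h y)) (0 : ℝ)| ≤ ‖v‖ * |C| := fun v y => by
    rw [abs_of_nonneg (le_max_right _ _)]
    exact max_le ((le_abs_self _).trans (abs_inner_le_of_norm_le hC' v y)) (by positivity)
  have hint : ∀ v, Integrable (fun y => max (inner ℝ v (h y)) (0 : ℝ)) ν := fun v =>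
    integrable_of_abs_le (by fun_prop) (hbd v)
  have hpcont : Continuous p := by
    refine continuous_iff_continuousAt.2 fun v => ?_
    refine continuousAt_of_dominated (bound := fun _ => (‖v‖ + 1) * |C|)
      (Eventually.of_forall fun w => by fun_prop) ?_ (integrable_const _)
      (ae_of_all _ fun y => by fun_prop)
    filter_upwards [Metric.ball_mem_nhds v one_pos] with w hw
    refine ae_of_all _ fun y => (hbd w y).trans ?_
    have h1 := norm_le_norm_add_norm_sub' w v
    have h2 : ‖w - v‖ < 1 := by simpa [dist_eq_norm] using hw
    gcongr
    linarith
  have hphom : ∀ (c : ℝ), 0 ≤ c → ∀ v, p (c • v) = c * p v := by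
    intro c hc v
    simp only [p, ← integral_const_mul, real_inner_smul_left]
    congr 1 with y
    rw [mul_max_of_nonneg _ _ hc, mul_zero]
  have hple : ∀ v, p v ≤ partitionFn ν h 0 0 v := fun v => by
    refine integral_mono (hint v)
      (integrable_partitionFn hh hC measurable_zero (D := 0) (by simp) 0 v) fun y => ?_
    simp only [zero_mul, add_zero]
    exact max_le ((le_add_of_nonneg_right zero_le_one).trans (Real.add_one_le_exp _))
      (Real.exp_pos _).le
  have hppos : ∀ v ∈ Nᗮ, ‖v‖ = 1 → 0 < p v := by
    intro v hv hv1
    refine (integral_nonneg fun y => le_max_right _ _).lt_of_ne' fun h0 => ?_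
    have h1 := (integral_eq_zero_iff_of_nonneg (fun y => le_max_right _ _) (hint v)).1 h0
    have h2 : ∀ᵐ y ∂μ, inner ℝ v (h y) ≤ (0 : ℝ) := by
      filter_upwards [hμν.ae_le h1] with y hy
      simpa using hy
    have hhint : Integrable h μ := Integrable.of_bound hh.aestronglyMeasurable C (ae_of_all _ hC)
    have h3 : ∫ y, inner ℝ v (h y) ∂μ = (0 : ℝ) := by
      rw [integral_inner hhint, hmean, inner_zero_right]
    have h4 : (fun y => -(inner ℝ v (h y) : ℝ)) =ᵐ[μ] 0 := by
      refine (integral_eq_zero_iff_of_nonneg_ae ?_ ?_).1 ?_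
      · filter_upwards [h2] with y hy
        simpa using hy
      · exact (integrable_of_abs_le (by fun_prop) (abs_inner_le_of_norm_le hC v)).neg
      · rw [integral_neg, h3, neg_zero]
    have h5 : v ∈ N := by
      change ∀ᵐ y ∂ν, _
      filter_upwards [hνμ.ae_le h4] with y hy
      simpa using hy
    have h6 : inner ℝ v v = (0 : ℝ) := (Submodule.mem_orthogonal N v).1 hv v h5
    rw [real_inner_self_eq_norm_sq, hv1] at h6
    norm_num at h6
  obtain ⟨c, hc, hcp⟩ : ∃ c > 0, ∀ v ∈ Nᗮ, c * ‖v‖ ≤ p v := by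
    have hcomp : IsCompact ((Nᗮ : Set V) ∩ Metric.sphere 0 1) :=
      (isCompact_sphere 0 1).inter_left (Submodule.closed_of_finiteDimensional _)
    obtain ⟨c, hc, hcp⟩ : ∃ c > 0, ∀ v ∈ (Nᗮ : Set V) ∩ Metric.sphere 0 1, c ≤ p v := by
      rcases Set.eq_empty_or_nonempty ((Nᗮ : Set V) ∩ Metric.sphere 0 1) with he | hne
      · exact ⟨1, one_pos, by simp [he]⟩
      · obtain ⟨v, hv, hmin⟩ := hcomp.exists_isMinOn hne hpcont.continuousOn
        exact ⟨p v, hppos v hv.1 (by simpa using hv.2), fun w hw => hmin hw⟩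
    refine ⟨c, hc, fun v hv => ?_⟩
    rcases eq_or_ne v 0 with rfl | hv0
    · simp [p]
    · have h1 : c ≤ p (‖v‖⁻¹ • v) := hcp _ ⟨Submodule.smul_mem _ _ hv, by
        simp [norm_smul, hv0]⟩
      rw [hphom _ (by positivity)] at h1
      have hv' : 0 < ‖v‖ := norm_pos_iff.2 hv0
      calc c * ‖v‖ ≤ (‖v‖⁻¹ * p v) * ‖v‖ := by gcongr
        _ = p v := by field_simp
  have hcont := continuous_partitionFn (ν := ν) hh hC measurable_zero (D := 0) (by simp) 0
  obtain ⟨v, hv⟩ : ∃ v : Nᗮ, ∀ w : Nᗮ, partitionFn ν h 0 0 (v : V) ≤ partitionFn ν h 0 0 w := by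
    refine (hcont.comp continuous_subtype_val).exists_forall_le ?_
    refine tendsto_atTop_mono (f := fun w : Nᗮ => c * ‖w‖)
      (fun w => (hcp w w.2).trans (hple w)) ?_
    exact (tendsto_norm_cocompact_atTop (E := Nᗮ)).const_mul_atTop hc
  refine ⟨v, fun w => ?_⟩
  obtain ⟨a, ha, b, hb, rfl⟩ := N.exists_add_mem_mem_orthogonal w
  refine (hv ⟨b, hb⟩).trans_eq ?_
  refine integral_congr_ae ?_
  filter_upwards [show ∀ᵐ y ∂ν, inner ℝ a (h y) = (0 : ℝ) from ha] with y hy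
  simp [inner_add_left, hy]

/-- The first-order condition at a minimizer of the partition function: the tilted density gives
the moment function mean zero. -/
lemma integral_exp_smul_eq_zero (hh : Measurable h) (hC : ∀ y, ‖h y‖ ≤ C) {v : V}
    (hv : ∀ w, partitionFn ν h 0 0 v ≤ partitionFn ν h 0 0 w) :
    ∫ y, Real.exp (inner ℝ v (h y)) • h y ∂ν = 0 := by
  have hint : Integrable (fun y => Real.exp (inner ℝ v (h y)) • h y) ν := by
    refine Integrable.of_bound (by fun_prop) (Real.exp (‖v‖ * C) * C) (ae_of_all _ fun y => ?_)
    rw [norm_smul, Real.norm_eq_abs, Real.abs_exp]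
    gcongr
    · exact (le_abs_self _).trans (abs_inner_le_of_norm_le hC v y)
    · exact hC y
  refine ext_inner_left ℝ fun w => ?_
  rw [← integral_inner hint, inner_zero_right]
  have hd := hasDerivAt_integral_exp_add_mul (ν := ν) (u := fun y => inner ℝ v (h y))
    (φ := fun y => inner ℝ w (h y)) (by fun_prop) (by fun_prop)
    (abs_inner_le_of_norm_le hC v) (abs_inner_le_of_norm_le hC w)
  have hmin : IsLocalMin
      (fun t : ℝ => ∫ y, Real.exp (inner ℝ v (h y) + t * inner ℝ w (h y)) ∂ν) 0 := by
    refine Eventually.of_forall fun t => ?_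
    simpa [partitionFn, inner_add_left, real_inner_smul_left] using hv (v + t • w)
  rw [← hmin.hasDerivAt_eq_zero hd]
  congr 1 with y
  rw [real_inner_smul_right, mul_comm]

/-- The value function `t ↦ inf_v ∫ exp (⟨v, h⟩ + t φ) dν`, written as an infimum over a countable
dense set of vectors so that it depends measurably on parameters of `h`. -/
def valueFn (ν : Measure α) (h : α → V) (φ : α → ℝ) (t : ℝ) : ℝ :=
  ⨅ n : ℕ, partitionFn ν h φ t (TopologicalSpace.denseSeq V n)

omit [FiniteDimensional ℝ V] [MeasurableSpace V] [BorelSpace V] [IsFiniteMeasure ν] in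
lemma partitionFn_nonneg (φ : α → ℝ) (t : ℝ) (v : V) : 0 ≤ partitionFn ν h φ t v :=
  integral_nonneg fun _ => (Real.exp_pos _).le

lemma valueFn_le (hh : Measurable h) (hC : ∀ y, ‖h y‖ ≤ C) {φ : α → ℝ}
    (hφ : Measurable φ) {D : ℝ} (hD : ∀ y, |φ y| ≤ D) (t : ℝ) (v : V) :
    valueFn ν h φ t ≤ partitionFn ν h φ t v := by
  refine (TopologicalSpace.denseRange_denseSeq V).induction_on v ?_ fun n => ?_
  · exact isClosed_le continuous_const (continuous_partitionFn hh hC hφ hD t)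
  · exact ciInf_le ⟨0, by rintro _ ⟨m, rfl⟩; exact partitionFn_nonneg _ _ _⟩ n

lemma two_mul_partitionFn_midpoint_le (hh : Measurable h) (hC : ∀ y, ‖h y‖ ≤ C) {φ : α → ℝ}
    (hφ : Measurable φ) {D : ℝ} (hD : ∀ y, |φ y| ≤ D) (t : ℝ) (v w : V) :
    2 * partitionFn ν h φ 0 ((2⁻¹ : ℝ) • (v + w)) ≤
      partitionFn ν h φ t v + partitionFn ν h φ (-t) w := by
  unfold partitionFn
  have i1 := integrable_partitionFn (ν := ν) hh hC hφ hD t v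
  have i2 := integrable_partitionFn (ν := ν) hh hC hφ hD (-t) w
  rw [← integral_const_mul, ← integral_add i1 i2]
  refine integral_mono ((integrable_partitionFn hh hC hφ hD 0 _).const_mul 2) (i1.add i2)
    fun y => ?_
  have hab : ∀ a b : ℝ, 2 * Real.exp (2⁻¹ * (a + b)) ≤ Real.exp a + Real.exp b := fun a b => by
    have ha : Real.exp a = Real.exp (a / 2) ^ 2 := by rw [← Real.exp_nat_mul]; congr 1; ring
    have hb : Real.exp b = Real.exp (b / 2) ^ 2 := by rw [← Real.exp_nat_mul]; congr 1; ring
    rw [ha, hb, show 2⁻¹ * (a + b) = a / 2 + b / 2 by ring, Real.exp_add]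
    linarith [two_mul_le_add_sq (Real.exp (a / 2)) (Real.exp (b / 2))]
  refine le_trans (le_of_eq ?_)
    (hab (inner ℝ v (h y) + t * φ y) (inner ℝ w (h y) + -t * φ y))
  simp only [real_inner_smul_left, inner_add_left]
  ring_nf

/-- The envelope theorem: the value function is differentiable at `0`, with the derivative of
the partition function at any fixed minimizer. It is convex and touches the smooth function
`t ↦ ∫ exp (⟨v, h⟩ + t φ) dν` from below at `0`. -/
lemma tendsto_valueFn_slope (hh : Measurable h) (hC : ∀ y, ‖h y‖ ≤ C) {φ : α → ℝ}
    (hφ : Measurable φ) {D : ℝ} (hD : ∀ y, |φ y| ≤ D) {v : V}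
    (hv : ∀ w, partitionFn ν h 0 0 v ≤ partitionFn ν h 0 0 w) :
    Tendsto (fun n : ℕ => ((n : ℝ) + 1) *
        (valueFn ν h φ ((n : ℝ) + 1)⁻¹ - valueFn ν h φ 0)) atTop
      (𝓝 (∫ y, φ y * Real.exp (inner ℝ v (h y)) ∂ν)) := by
  have h00 : ∀ w, partitionFn ν h φ 0 w = partitionFn ν h 0 0 w := fun w => by
    simp [partitionFn]
  have hv0 : valueFn ν h φ 0 = partitionFn ν h φ 0 v := by
    refine (valueFn_le hh hC hφ hD 0 v).antisymm (le_ciInf fun n => ?_)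
    rw [h00, h00]
    exact hv _
  have hmid : ∀ t, 2 * valueFn ν h φ 0 - partitionFn ν h φ (-t) v ≤ valueFn ν h φ t := by
    refine fun t => le_ciInf fun n => ?_
    have h1 := two_mul_partitionFn_midpoint_le (ν := ν) hh hC hφ hD t
      (TopologicalSpace.denseSeq V n) v
    have h2 := valueFn_le (ν := ν) hh hC hφ hD 0
      ((2⁻¹ : ℝ) • (TopologicalSpace.denseSeq V n + v))
    linarith
  have hd : HasDerivAt (fun t => partitionFn ν h φ t v)
      (∫ y, φ y * Real.exp (inner ℝ v (h y)) ∂ν) 0 :=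
    hasDerivAt_integral_exp_add_mul (u := fun y => inner ℝ v (h y)) (by fun_prop) hφ
      (abs_inner_le_of_norm_le hC v) hD
  have hslope := hasDerivAt_iff_tendsto_slope_zero.1 hd
  have ht : Tendsto (fun n : ℕ => ((n : ℝ) + 1)⁻¹) atTop (𝓝[≠] 0) := by
    refine tendsto_nhdsWithin_iff.2 ⟨?_, Eventually.of_forall fun n => ?_⟩
    · simpa using tendsto_one_div_add_atTop_nhds_zero_nat (𝕜 := ℝ)
    · simp only [Set.mem_compl_iff, Set.mem_singleton_iff]
      positivity
  have ht' : Tendsto (fun n : ℕ => -((n : ℝ) + 1)⁻¹) atTop (𝓝[≠] 0) := by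
    refine tendsto_nhdsWithin_iff.2 ⟨?_, Eventually.of_forall fun n => ?_⟩
    · simpa using (tendsto_one_div_add_atTop_nhds_zero_nat (𝕜 := ℝ)).neg
    · simp only [Set.mem_compl_iff, Set.mem_singleton_iff, neg_eq_zero]
      positivity
  refine tendsto_of_tendsto_of_tendsto_of_le_of_le (hslope.comp ht') (hslope.comp ht) ?_ ?_
  · intro n
    have h1 := hmid ((n : ℝ) + 1)⁻¹
    have h2 : (0 : ℝ) < (n : ℝ) + 1 := by positivity
    simp only [Function.comp, zero_add, smul_eq_mul, inv_neg, inv_inv]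
    rw [← hv0, neg_mul, ← mul_neg]
    gcongr
    linarith
  · intro n
    have h1 := valueFn_le (ν := ν) hh hC hφ hD ((n : ℝ) + 1)⁻¹ v
    have h2 : (0 : ℝ) < (n : ℝ) + 1 := by positivity
    simp only [Function.comp, zero_add, smul_eq_mul, inv_inv]
    rw [hv0]
    gcongr

lemma measurable_valueFn {X : Type*} [MeasurableSpace X]
    {H : X → α → V}
    (hH : Measurable (Function.uncurry H)) {φ : α → ℝ} (hφ : Measurable φ) (t : ℝ) :
    Measurable fun x => valueFn ν (H x) φ t := by
  refine Measurable.iInf fun n => ?_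
  refine (StronglyMeasurable.integral_prod_right (ν := ν) (f := fun x y =>
    Real.exp (inner ℝ (TopologicalSpace.denseSeq V n) (H x y) + t * φ y)) ?_).measurable
  refine Measurable.stronglyMeasurable ?_
  have h1 : Measurable fun p : X × α => H p.1 p.2 := hH
  change Measurable fun p : X × α =>
    Real.exp (inner ℝ (TopologicalSpace.denseSeq V n) (H p.1 p.2) + t * φ p.2)
  fun_prop

/-- Minimizers `v x` of the partition functions of a measurable family `H x` give measurable
integrals, although `v` itself need not be measurable. -/
lemma measurable_integral_mul_exp_of_forall_le {X : Type*} [MeasurableSpace X]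
    {H : X → α → V} (hH : Measurable (Function.uncurry H)) (hC : ∀ x y, ‖H x y‖ ≤ C)
    {φ : α → ℝ} (hφ : Measurable φ) {D : ℝ} (hD : ∀ y, |φ y| ≤ D) {v : X → V}
    (hv : ∀ x w, partitionFn ν (H x) 0 0 (v x) ≤ partitionFn ν (H x) 0 0 w) :
    Measurable fun x => ∫ y, φ y * Real.exp (inner ℝ (v x) (H x y)) ∂ν := by
  refine measurable_of_tendsto_metrizable
    (f := fun (n : ℕ) x => ((n : ℝ) + 1) *
      (valueFn ν (H x) φ ((n : ℝ) + 1)⁻¹ - valueFn ν (H x) φ 0)) (fun n => ?_)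
    (tendsto_pi_nhds.2 fun x =>
      tendsto_valueFn_slope (hH.comp measurable_prodMk_left) (hC x) hφ hD (hv x))
  exact ((measurable_valueFn hH hφ _).sub (measurable_valueFn hH hφ _)).const_mul _

end PartitionFunction

/-! ### Exponential tilting and relative entropy -/

section Entropy

open InformationTheory

variable {α : Type*} [MeasurableSpace α] {ν γ : Measure α} {u : α → ℝ} {C : ℝ}

lemma tilted_sub_const (ν : Measure α) (u : α → ℝ) (c : ℝ) :
    ν.tilted (fun y => u y - c) = ν.tilted u := by
  unfold Measure.tilted
  simp_rw [Real.exp_sub, integral_div]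
  congr 1 with y
  rw [div_div_div_cancel_right₀ (Real.exp_pos c).ne']

lemma klDiv_tilted_ne_top [IsProbabilityMeasure ν] (hu : Measurable u) (hC : ∀ y, |u y| ≤ C) :
    klDiv (ν.tilted u) ν ≠ ⊤ := by
  have hexp := integrable_exp_of_abs_le (ν := ν) hu hC
  have := isProbabilityMeasure_tilted hexp
  refine klDiv_ne_top (tilted_absolutelyContinuous ν u) ?_
  have hlog : llr (ν.tilted u) ν =ᵐ[ν.tilted u]
      fun y => u y - Real.log (∫ z, Real.exp (u z) ∂ν) :=
    (tilted_absolutelyContinuous ν u).ae_le (log_rnDeriv_tilted_left_self hexp)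
  rw [integrable_congr hlog]
  exact (integrable_of_abs_le hu hC).sub (integrable_const _)

/-- The relative entropies with respect to `ν` and to `ν.tilted u` differ by an affine functional
of the mean of `u`. -/
lemma toReal_klDiv_eq_toReal_klDiv_tilted_add [IsProbabilityMeasure ν] [IsProbabilityMeasure γ]
    (hu : Measurable u) (hC : ∀ y, |u y| ≤ C) (hγ : klDiv γ ν ≠ ⊤) :
    klDiv γ (ν.tilted u) ≠ ⊤ ∧
    (klDiv γ ν).toReal = (klDiv γ (ν.tilted u)).toReal
      + (∫ y, u y ∂γ - Real.log (∫ y, Real.exp (u y) ∂ν)) := by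
  have hexp := integrable_exp_of_abs_le (ν := ν) hu hC
  have := isProbabilityMeasure_tilted hexp
  obtain ⟨hac, hint⟩ := klDiv_ne_top_iff.1 hγ
  have huγ := integrable_of_abs_le (ν := γ) hu hC
  have hac' : γ ≪ ν.tilted u := hac.trans (absolutelyContinuous_tilted hexp)
  refine ⟨klDiv_ne_top hac' (integrable_llr_tilted_right hac huγ hint hexp), ?_⟩
  rw [toReal_klDiv_of_measure_eq hac (by simp), toReal_klDiv_of_measure_eq hac' (by simp),
    integral_llr_tilted_right hac huγ hexp hint]
  ring

/-- Among the probability measures giving `u` the same mean, the exponential tilt of `ν` by `u` is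
the only minimizer of the relative entropy with respect to `ν`: the excess entropy of `γ` is its
relative entropy with respect to the tilt. -/
lemma klDiv_tilted_le_and_eq_of_klDiv_le [IsProbabilityMeasure ν] [IsProbabilityMeasure γ]
    (hu : Measurable u) (hC : ∀ y, |u y| ≤ C) (hmean : ∫ y, u y ∂γ = ∫ y, u y ∂(ν.tilted u)) :
    klDiv (ν.tilted u) ν ≤ klDiv γ ν ∧
      (klDiv γ ν ≤ klDiv (ν.tilted u) ν → γ = ν.tilted u) := by
  have := isProbabilityMeasure_tilted (integrable_exp_of_abs_le (ν := ν) hu hC)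
  have htop := klDiv_tilted_ne_top (ν := ν) hu hC
  obtain ⟨-, hself⟩ := toReal_klDiv_eq_toReal_klDiv_tilted_add hu hC htop
  rw [klDiv_self, ENNReal.toReal_zero, zero_add, ← hmean] at hself
  constructor
  · rcases eq_or_ne (klDiv γ ν) ⊤ with hγ | hγ
    · simp [hγ]
    · obtain ⟨-, h⟩ := toReal_klDiv_eq_toReal_klDiv_tilted_add hu hC hγ
      rw [← ENNReal.toReal_le_toReal htop hγ, h, hself]
      exact le_add_of_nonneg_left ENNReal.toReal_nonneg
  · intro hle
    have hγ : klDiv γ ν ≠ ⊤ := ne_top_of_le_ne_top htop hle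
    obtain ⟨hne, h⟩ := toReal_klDiv_eq_toReal_klDiv_tilted_add hu hC hγ
    rw [← ENNReal.toReal_le_toReal hγ htop, h, hself] at hle
    have h0 : (klDiv γ (ν.tilted u)).toReal = 0 :=
      le_antisymm (by linarith) ENNReal.toReal_nonneg
    rw [ENNReal.toReal_eq_zero_iff, or_iff_left hne] at h0
    exact klDiv_eq_zero_iff.1 h0

end Entropy

/-! ### Couplings adapted to a finite partition -/

section Coupling

variable {X : Type*} [MeasurableSpace X]

lemma exists_map_fst_eq_map_snd_eq {α β : Measure X} [IsFiniteMeasure α] [IsFiniteMeasure β]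
    (hαβ : α Set.univ = β Set.univ) :
    ∃ π : Measure (X × X), π.map Prod.fst = α ∧ π.map Prod.snd = β := by
  rcases eq_or_ne (α Set.univ) 0 with h0 | h0
  · have hβ := hαβ ▸ h0
    rw [Measure.measure_univ_eq_zero] at h0 hβ
    exact ⟨0, by simp [h0], by simp [hβ]⟩
  · refine ⟨(α Set.univ)⁻¹ • α.prod β, ?_, ?_⟩
    · rw [Measure.map_smul, Measure.map_fst_prod, ← hαβ, smul_smul,
        ENNReal.inv_mul_cancel h0 (measure_ne_top _ _), one_smul]
    · rw [Measure.map_smul, Measure.map_snd_prod, smul_smul,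
        ENNReal.inv_mul_cancel h0 (measure_ne_top _ _), one_smul]

lemma exists_add_eq_of_le_measure_univ (μ : Measure X) [IsFiniteMeasure μ] {m : ENNReal}
    (hm : m ≤ μ Set.univ) :
    ∃ α β : Measure X, α + β = μ ∧ α Set.univ = m ∧ β Set.univ = μ Set.univ - m := by
  have hmass : m / μ Set.univ * μ Set.univ = m := by
    rcases eq_or_ne (μ Set.univ) 0 with h0 | h0
    · simp [h0, nonpos_iff_eq_zero.1 (hm.trans_eq h0)]
    · exact ENNReal.div_mul_cancel h0 (measure_ne_top _ _)
  refine ⟨(m / μ Set.univ) • μ, (1 - m / μ Set.univ) • μ, ?_, ?_, ?_⟩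
  · rw [← add_smul, add_tsub_cancel_of_le (ENNReal.div_le_of_le_mul (by simpa using hm)),
      one_smul]
  · simpa using hmass
  · rw [Measure.smul_apply, smul_eq_mul, ENNReal.sub_mul (fun _ _ => measure_ne_top _ _), one_mul,
      hmass]

/-- Two probability measures which give nearly equal masses to the cells of a finite partition can
be coupled cheaply: the common mass `min (μ (A i)) (γ (A i))` is transported inside the cell `A i`,
and the remaining mass anywhere. -/
lemma exists_coupling_lintegral_le {μ γ : Measure X} [IsProbabilityMeasure μ]
    [IsProbabilityMeasure γ] {ι : Type*} (s : Finset ι) {A : ι → Set X}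
    (hA : ∀ i, MeasurableSet (A i)) (hdisj : Pairwise (Function.onFun Disjoint A))
    (hcover : ⋃ i ∈ s, A i = Set.univ) (c : X × X → ENNReal) {δ D : ENNReal}
    (hδ : ∀ i ∈ s, ∀ x ∈ A i, ∀ y ∈ A i, c (x, y) ≤ δ) (hD : ∀ p, c p ≤ D) :
    ∃ π : Measure (X × X), π.map Prod.fst = μ ∧ π.map Prod.snd = γ ∧
      ∫⁻ p, c p ∂π ≤ δ + D * ∑ i ∈ s, (μ (A i) - γ (A i)) := by
  have hdec : ∀ ρ : Measure X, ∑ i ∈ s, ρ.restrict (A i) = ρ := fun ρ => by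
    have h := Measure.restrict_biUnion_finset (μ := ρ) (T := s) (s := A)
      (fun i _ j _ hij => hdisj hij) hA
    rw [hcover, Measure.restrict_univ] at h
    conv_rhs => rw [h]
    rw [Measure.sum_fintype, Finset.sum_coe_sort s fun i => ρ.restrict (A i)]
  choose α α' hαadd hα hα' using fun i =>
    exists_add_eq_of_le_measure_univ (μ.restrict (A i)) (m := min (μ (A i)) (γ (A i))) (by simp)
  choose β β' hβadd hβ hβ' using fun i =>
    exists_add_eq_of_le_measure_univ (γ.restrict (A i)) (m := min (μ (A i)) (γ (A i))) (by simp)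
  have hαfin : ∀ i, IsFiniteMeasure (α i) := fun i => ⟨by
    rw [hα]; exact (min_le_left _ _).trans_lt (measure_lt_top _ _)⟩
  have hβfin : ∀ i, IsFiniteMeasure (β i) := fun i => ⟨by
    rw [hβ]; exact (min_le_left _ _).trans_lt (measure_lt_top _ _)⟩
  choose π hπ1 hπ2 using fun i => exists_map_fst_eq_map_snd_eq ((hα i).trans (hβ i).symm)
  have hμadd : ∑ i ∈ s, α i + ∑ i ∈ s, α' i = μ := by
    rw [← Finset.sum_add_distrib, Finset.sum_congr rfl fun i _ => hαadd i, hdec]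
  have hγadd : ∑ i ∈ s, β i + ∑ i ∈ s, β' i = γ := by
    rw [← Finset.sum_add_distrib, Finset.sum_congr rfl fun i _ => hβadd i, hdec]
  have hsum : (∑ i ∈ s, α i) Set.univ = (∑ i ∈ s, β i) Set.univ := by
    rw [Measure.finsetSum_apply, Measure.finsetSum_apply]
    exact Finset.sum_congr rfl fun i _ => (hα i).trans (hβ i).symm
  have hα'univ : (∑ i ∈ s, α' i) Set.univ = ∑ i ∈ s, (μ (A i) - γ (A i)) := by
    rw [Measure.finsetSum_apply]
    refine Finset.sum_congr rfl fun i _ => ?_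
    rw [hα', Measure.restrict_apply_univ, tsub_min]
  have hμuniv := congrArg (fun ρ : Measure X => ρ Set.univ) hμadd
  have hγuniv := congrArg (fun ρ : Measure X => ρ Set.univ) hγadd
  simp only [Measure.add_apply, measure_univ] at hμuniv hγuniv
  have hfinA : IsFiniteMeasure (∑ i ∈ s, α' i) :=
    ⟨(le_add_self.trans_eq hμuniv).trans_lt ENNReal.one_lt_top⟩
  have hfinB : IsFiniteMeasure (∑ i ∈ s, β' i) :=
    ⟨(le_add_self.trans_eq hγuniv).trans_lt ENNReal.one_lt_top⟩
  have hrest : (∑ i ∈ s, α' i) Set.univ = (∑ i ∈ s, β' i) Set.univ := by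
    have hne : (∑ i ∈ s, α i) Set.univ ≠ ⊤ :=
      ((le_self_add.trans_eq hμuniv).trans_lt ENNReal.one_lt_top).ne
    refine (ENNReal.add_right_inj hne).1 ?_
    rw [hμuniv, hsum, hγuniv]
  obtain ⟨π', hπ'1, hπ'2⟩ := exists_map_fst_eq_map_snd_eq hrest
  have huniv : ∀ (ρ : Measure (X × X)) (τ : Measure X), ρ.map Prod.fst = τ →
      ρ Set.univ = τ Set.univ := fun ρ τ h => by
    rw [← h, Measure.map_apply measurable_fst MeasurableSet.univ, Set.preimage_univ]
  refine ⟨∑ i ∈ s, π i + π', ?_, ?_, ?_⟩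
  · rw [Measure.map_add _ _ measurable_fst, Measure.map_finset_sum measurable_fst.aemeasurable,
      hπ'1, Finset.sum_congr rfl fun i _ => hπ1 i, hμadd]
  · rw [Measure.map_add _ _ measurable_snd, Measure.map_finset_sum measurable_snd.aemeasurable,
      hπ'2, Finset.sum_congr rfl fun i _ => hπ2 i, hγadd]
  · rw [lintegral_add_measure, lintegral_finsetSum_measure]
    refine add_le_add ?_ ?_
    · have hcell : ∀ i ∈ s, ∫⁻ p, c p ∂π i ≤ δ * α i Set.univ := fun i hi => by
        have hα0 : α i (A i)ᶜ = 0 := by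
          have h : α i (A i)ᶜ ≤ (μ.restrict (A i)) (A i)ᶜ := by
            rw [← hαadd i]; exact le_self_add
          simpa [Measure.restrict_apply (hA i).compl] using h
        have hβ0 : β i (A i)ᶜ = 0 := by
          have h : β i (A i)ᶜ ≤ (γ.restrict (A i)) (A i)ᶜ := by
            rw [← hβadd i]; exact le_self_add
          simpa [Measure.restrict_apply (hA i).compl] using h
        rw [← hπ1, Measure.map_apply measurable_fst (hA i).compl] at hα0
        rw [← hπ2, Measure.map_apply measurable_snd (hA i).compl] at hβ0
        rw [← huniv _ _ (hπ1 i), ← lintegral_const]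
        refine lintegral_mono_ae ?_
        filter_upwards [compl_mem_ae_iff.2 hα0, compl_mem_ae_iff.2 hβ0] with p h1 h2
        exact hδ i hi p.1 (by simpa using h1) p.2 (by simpa using h2)
      calc ∑ i ∈ s, ∫⁻ p, c p ∂π i ≤ ∑ i ∈ s, δ * α i Set.univ := Finset.sum_le_sum hcell
        _ = δ * (∑ i ∈ s, α i) Set.univ := by rw [Measure.finsetSum_apply, Finset.mul_sum]
        _ ≤ δ * 1 := by gcongr; exact le_self_add.trans_eq hμuniv
        _ = δ := mul_one δ
    · calc ∫⁻ p, c p ∂π' ≤ ∫⁻ _, D ∂π' := lintegral_mono hD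
        _ = D * ∑ i ∈ s, (μ (A i) - γ (A i)) := by
          rw [lintegral_const, huniv _ _ hπ'1, hα'univ]

end Coupling

/-! ### Measurability of maps into the Wasserstein space of a compact set -/

section Wasserstein

variable {d : ℕ} {E : Set (EuclideanSpace ℝ (Fin d))}

lemma l1Cost_le (x y : E) : l1Cost x y ≤ d * dist x y := by
  calc l1Cost x y ≤ ∑ _i : Fin d, dist x y := by
        refine Finset.sum_le_sum fun i _ => ?_
        have h := PiLp.norm_apply_le
          ((x : EuclideanSpace ℝ (Fin d)) - (y : EuclideanSpace ℝ (Fin d))) i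
        rwa [PiLp.sub_apply, Real.norm_eq_abs, ← dist_eq_norm] at h
    _ = d * dist x y := by simp

/-- Countably many cells of `E`: for each `n` the sets `cell (n, i)`, `i : ℕ`, partition `E` into
sets of diameter at most `2 / (n + 1)`. -/
def cell [Nonempty E] (p : ℕ × ℕ) : Set E :=
  disjointed (fun i => Metric.ball (TopologicalSpace.denseSeq E i) ((p.1 : ℝ) + 1)⁻¹) p.2

lemma measurableSet_cell [Nonempty E] (p : ℕ × ℕ) : MeasurableSet (cell (E := E) p) :=
  MeasurableSet.disjointed (fun _ => Metric.isOpen_ball.measurableSet) _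

lemma dist_le_of_mem_cell [Nonempty E] {p : ℕ × ℕ} {x y : E} (hx : x ∈ cell p)
    (hy : y ∈ cell p) : dist x y ≤ 2 * ((p.1 : ℝ) + 1)⁻¹ := by
  have hsub := disjointed_subset
    (fun i => Metric.ball (TopologicalSpace.denseSeq E i) ((p.1 : ℝ) + 1)⁻¹) p.2
  have h1 := Metric.mem_ball.1 (hsub hx)
  have h2 := Metric.mem_ball'.1 (hsub hy)
  linarith [dist_triangle x (TopologicalSpace.denseSeq E p.2) y]

lemma exists_biUnion_cell_eq_univ [Nonempty E] (hE : IsCompact E) (n : ℕ) :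
    ∃ N : ℕ, ⋃ i ∈ Finset.range N, cell (E := E) (n, i) = Set.univ := by
  have := isCompact_iff_compactSpace.1 hE
  have hr : (0 : ℝ) < ((n : ℝ) + 1)⁻¹ := by positivity
  obtain ⟨t, ht⟩ := isCompact_univ.elim_finite_subcover
    (fun i => Metric.ball (TopologicalSpace.denseSeq E i) ((n : ℝ) + 1)⁻¹)
    (fun _ => Metric.isOpen_ball) (fun x _ => by
      obtain ⟨i, hi⟩ := (TopologicalSpace.denseRange_denseSeq E).exists_dist_lt x hr
      exact Set.mem_iUnion.2 ⟨i, hi⟩)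
  refine ⟨t.sup id + 1, Set.eq_univ_of_forall fun x => ?_⟩
  have h := biUnion_range_succ_disjointed
    (fun i => Metric.ball (TopologicalSpace.denseSeq E i) ((n : ℝ) + 1)⁻¹) (t.sup id)
  change x ∈ ⋃ i ∈ Finset.range (t.sup id + 1), disjointed _ i
  rw [h, partialSups_eq_biUnion_range]
  obtain ⟨i, hit, hi⟩ := Set.mem_iUnion₂.1 (ht (Set.mem_univ x))
  exact Set.mem_iUnion₂.2
    ⟨i, Finset.mem_range.2 (Nat.lt_succ_of_le (Finset.le_sup (f := id) hit)), hi⟩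

/-- A set which is open for `W₁` is the preimage of an open set under the map recording the masses
of the countably many cells. -/
lemma exists_isOpen_preimage_eq [Nonempty E] (hE : IsCompact E) {U : Set (WassersteinOne E)}
    (hU : IsOpen U) :
    ∃ O : Set (ℕ × ℕ → ENNReal), IsOpen O ∧ (fun μ p => μ.toMeasure (cell p)) ⁻¹' O = U := by
  let J : WassersteinOne E → ℕ × ℕ → ENNReal := fun μ p => μ.toMeasure (cell p)
  refine ⟨⋃₀ {O | IsOpen O ∧ J ⁻¹' O ⊆ U}, isOpen_sUnion fun O hO => hO.1, ?_⟩
  refine Set.Subset.antisymm (fun μ hμ => ?_) fun μ hμ => ?_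
  · obtain ⟨O, hO, hμO⟩ := hμ
    exact hO.2 hμO
  obtain ⟨ε, hε, hεU⟩ := hU μ hμ
  have hbdd : Bornology.IsBounded E := hE.isBounded
  let D : ENNReal := ENNReal.ofReal (d * Metric.diam E)
  have hhalf : 0 < ε / 2 := ENNReal.half_pos hε.ne'
  obtain ⟨n, hn⟩ : ∃ n : ℕ, ENNReal.ofReal (d * (2 * ((n : ℝ) + 1)⁻¹)) < ε / 2 := by
    have h1 : Tendsto (fun n : ℕ => (d : ℝ) * (2 * ((n : ℝ) + 1)⁻¹)) atTop (𝓝 0) := by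
      simpa using ((tendsto_one_div_add_atTop_nhds_zero_nat (𝕜 := ℝ)).const_mul 2).const_mul
        (d : ℝ)
    have h2 := (ENNReal.continuous_ofReal.tendsto 0).comp h1
    rw [ENNReal.ofReal_zero] at h2
    exact (h2.eventually (gt_mem_nhds hhalf)).exists
  obtain ⟨N, hN⟩ := exists_biUnion_cell_eq_univ hE n
  have := μ.isProb
  refine ⟨{z | D * ∑ i ∈ Finset.range N, (J μ (n, i) - z (n, i)) < ε / 2}, ⟨?_, ?_⟩, ?_⟩
  · refine isOpen_lt ((ENNReal.continuous_const_mul ENNReal.ofReal_ne_top).comp ?_)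
      continuous_const
    exact continuous_finsetSum _ fun i _ =>
      (ENNReal.continuous_sub_left (measure_ne_top _ _)).comp (continuous_apply _)
  · intro γ hγ
    have := γ.isProb
    obtain ⟨π, hπ1, hπ2, hπ⟩ := exists_coupling_lintegral_le (μ := μ.toMeasure) (γ := γ.toMeasure)
      (Finset.range N) (A := fun i => cell (n, i)) (fun i => measurableSet_cell _)
      (disjoint_disjointed _) hN (fun p => ENNReal.ofReal (l1Cost p.1 p.2))
      (δ := ENNReal.ofReal (d * (2 * ((n : ℝ) + 1)⁻¹))) (D := D)
      (fun i _ x hx y hy => ENNReal.ofReal_le_ofReal <| (l1Cost_le x y).trans <| by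
        gcongr
        exact dist_le_of_mem_cell hx hy)
      (fun p => ENNReal.ofReal_le_ofReal <| (l1Cost_le p.1 p.2).trans <| by
        gcongr
        exact Metric.dist_le_diam_of_mem hbdd p.1.2 p.2.2)
    refine hεU γ ((iInf₂_le π ⟨hπ1, hπ2⟩).trans_lt (hπ.trans_lt ?_))
    rw [← ENNReal.add_halves ε]
    exact ENNReal.add_lt_add hn hγ
  · change D * ∑ i ∈ Finset.range N, (J μ (n, i) - J μ (n, i)) < ε / 2
    simpa only [tsub_self, Finset.sum_const_zero, mul_zero] using hhalf

/-- A map into the Wasserstein space of a compact set is measurable as soon as it is measurable as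
a map into the space of measures. -/
lemma measurable_wassersteinOne (hE : IsCompact E) {X : Type*} [MeasurableSpace X]
    {F : X → WassersteinOne E} (hF : ∀ A, MeasurableSet A → Measurable fun x => (F x).toMeasure A) :
    Measurable F := by
  have : BorelSpace (WassersteinOne E) := ⟨rfl⟩
  refine measurable_of_isOpen fun U hU => ?_
  rcases isEmpty_or_nonempty E with hempty | hne
  · have hX : F ⁻¹' U = ∅ := Set.eq_empty_of_forall_notMem fun x _ => by
      have h1 := (F x).isProb.measure_univ
      rw [Set.univ_eq_empty_iff.2 hempty, measure_empty] at h1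
      exact zero_ne_one h1
    rw [hX]
    exact MeasurableSet.empty
  · obtain ⟨O, hO, rfl⟩ := exists_isOpen_preimage_eq hE hU
    exact (measurable_pi_lambda (fun x (p : ℕ × ℕ) => (F x).toMeasure (cell p))
      fun p => hF _ (measurableSet_cell p)) hO.measurableSet

end Wasserstein

/-! ### The softmatch kernel -/

section Softmatch

variable {α : Type*} [MeasurableSpace α] {ν γ : Measure α}
  {V : Type*} [NormedAddCommGroup V] [InnerProductSpace ℝ V] [FiniteDimensional ℝ V]
  [MeasurableSpace V] [BorelSpace V] {h : α → V} {C : ℝ}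

/-- The tilt of `ν` along a minimizer of the partition function gives `h` mean zero. -/
lemma integral_tilted_eq_zero [IsFiniteMeasure ν] (hh : Measurable h) (hC : ∀ y, ‖h y‖ ≤ C)
    {v : V} (hv : ∀ w, partitionFn ν h 0 0 v ≤ partitionFn ν h 0 0 w) :
    ∫ y, h y ∂(ν.tilted fun y => inner ℝ v (h y)) = 0 := by
  rw [integral_tilted]
  simp_rw [div_eq_inv_mul, mul_smul]
  rw [integral_smul, integral_exp_smul_eq_zero hh hC hv, smul_zero]

lemma measurable_tilted_apply [IsFiniteMeasure ν] {X : Type*} [MeasurableSpace X]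
    {H : X → α → V} (hH : Measurable (Function.uncurry H)) (hC : ∀ x y, ‖H x y‖ ≤ C)
    {v : X → V} (hv : ∀ x w, partitionFn ν (H x) 0 0 (v x) ≤ partitionFn ν (H x) 0 0 w)
    {A : Set α} (hA : MeasurableSet A) :
    Measurable fun x => (ν.tilted fun y => inner ℝ (v x) (H x y)) A := by
  have key : ∀ B, MeasurableSet B → Measurable fun x =>
      ∫ y in B, Real.exp (inner ℝ (v x) (H x y)) ∂ν := fun B hB => by
    have h1 := measurable_integral_mul_exp_of_forall_le (ν := ν) hH hC
      (φ := B.indicator 1) (measurable_one.indicator hB) (D := 1)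
      (fun y => by by_cases hy : y ∈ B <;> simp [hy]) hv
    convert h1 using 2 with x
    rw [← integral_indicator hB]
    congr 1 with y
    by_cases hy : y ∈ B <;> simp [hy]
  have huniv := key _ MeasurableSet.univ
  simp only [Measure.restrict_univ] at huniv
  simp_rw [tilted_apply_eq_ofReal_integral' _ hA, integral_div]
  exact ((key A hA).div huniv).ennreal_ofReal

end Softmatch

lemma relEntropy_le_relEntropy_iff {d : ℕ} {E : Set (EuclideanSpace ℝ (Fin d))}
    {ν γ μ : WassersteinOne E} : relEntropy ν γ ≤ relEntropy ν μ ↔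
      InformationTheory.klDiv μ.toMeasure ν.toMeasure ≤
        InformationTheory.klDiv γ.toMeasure ν.toMeasure := by
  unfold relEntropy
  rw [EReal.neg_le_neg_iff, EReal.coe_ennreal_le_coe_ennreal_iff]

lemma lintegral_enorm_lt_top_of_isCompact {d : ℕ} {E : Set (EuclideanSpace ℝ (Fin d))}
    (hE : IsCompact E) (μ : Measure E) [IsFiniteMeasure μ] :
    ∫⁻ x : E, ‖(x : EuclideanSpace ℝ (Fin d))‖ₑ ∂μ < ⊤ := by
  obtain ⟨R, hR⟩ := hE.isBounded.exists_norm_le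
  exact (Integrable.of_bound (μ := μ) measurable_subtype_coe.aestronglyMeasurable R
    (ae_of_all _ fun x : E => hR x x.2)).2

end MaxEntAttention

end

open MeasureTheory ProbabilityTheory MaxEntAttention in
theorem mainTheorem2 {d l : ℕ}
    (E : Set (EuclideanSpace ℝ (Fin d))) (hE : IsCompact E)
    (E' : Set (EuclideanSpace ℝ (Fin l)))
    (k : E → E → E') (hk : Measurable (fun p : E × E => k p.1 p.2))
    (hkb : ∃ C : ℝ, ∀ x y, ‖(k x y : EuclideanSpace ℝ (Fin l))‖ ≤ C)
    (f : E → E') (hf : Measurable f)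
    (ν : WassersteinOne E)
    (hfeas : ∀ x, ∃ μ ∈ constraintSet k f ν x, ν.toMeasure ≪ μ.toMeasure) :
    ∃ (lam : E → EuclideanSpace ℝ (Fin l)) (μstar : E → WassersteinOne E),
      (∀ x, (μstar x).toMeasure =
        boltzmannGibbs (interactionPotential lam k x) ν.toMeasure) ∧
      (∀ x μ, IsMaxEnt k f ν x μ ↔ μ = μstar x) ∧
      Measurable μstar ∧
      ∃ κ : Kernel E E, IsMarkovKernel κ ∧
        (∀ x, κ x = (μstar x).toMeasure) ∧
        (∀ x, κ x = boltzmannGibbs (interactionPotential lam k x) ν.toMeasure) := by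
  have hν := ν.isProb
  obtain ⟨C, hkC⟩ := hkb
  let kv : E → E → EuclideanSpace ℝ (Fin l) := fun x y => k x y
  let fv : E → EuclideanSpace ℝ (Fin l) := fun x => f x
  have hkv : Measurable fun p : E × E => kv p.1 p.2 := measurable_subtype_coe.comp hk
  have hkx : ∀ x, Measurable (kv x) := fun x => hkv.comp measurable_prodMk_left
  have hfv : Measurable fv := measurable_subtype_coe.comp hf
  have hkint : ∀ x (μ : WassersteinOne E), Integrable (kv x) μ.toMeasure := fun x μ => by
    have := μ.isProb
    exact Integrable.of_bound (hkx x).aestronglyMeasurable C (ae_of_all _ (hkC x))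
  -- The targets are averages of `k`, hence obey the same bound.
  have hfC : ∀ x, ‖fv x‖ ≤ C := fun x => by
    obtain ⟨μ, ⟨-, -, hμ⟩, -⟩ := hfeas x
    have := μ.isProb
    have h1 := norm_integral_le_of_norm_le_const (μ := μ.toMeasure) (ae_of_all _ (hkC x))
    rw [hμ] at h1
    simpa using h1
  let H : E → E → EuclideanSpace ℝ (Fin l) := fun x y => kv x y - fv x
  have hH : Measurable (Function.uncurry H) := hkv.sub (hfv.comp measurable_fst)
  have hHx : ∀ x, Measurable (H x) := fun x => hH.comp measurable_prodMk_left
  have hHC : ∀ x y, ‖H x y‖ ≤ C + C := fun x y =>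
    (norm_sub_le _ _).trans (add_le_add (hkC x y) (hfC x))
  have hHmean : ∀ x (μ : WassersteinOne E),
      ∫ y, H x y ∂μ.toMeasure = ∫ y, kv x y ∂μ.toMeasure - fv x := fun x μ => by
    have := μ.isProb
    rw [integral_sub (hkint x μ) (integrable_const _)]
    simp
  have hmin : ∀ x, ∃ v, ∀ w, partitionFn ν.toMeasure (H x) 0 0 v ≤
      partitionFn ν.toMeasure (H x) 0 0 w := fun x => by
    obtain ⟨μ, ⟨hμν, -, hμ⟩, hνμ⟩ := hfeas x
    have := μ.isProb
    refine exists_forall_partitionFn_le (hHx x) (hHC x) hμν hνμ ?_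
    rw [hHmean]
    exact sub_eq_zero.2 hμ
  choose lam hlam using hmin
  let u : E → E → ℝ := fun x y => inner ℝ (lam x) (H x y)
  have hu : ∀ x, Measurable (u x) := fun x => Measurable.const_inner (hHx x)
  have huC : ∀ x y, |u x y| ≤ ‖lam x‖ * (C + C) := fun x => abs_inner_le_of_norm_le (hHC x) _
  have hprob : ∀ x, IsProbabilityMeasure (ν.toMeasure.tilted (u x)) := fun x =>
    isProbabilityMeasure_tilted (integrable_exp_of_abs_le (hu x) (huC x))
  let μstar : E → WassersteinOne E := fun x =>
    ⟨ν.toMeasure.tilted (u x), hprob x, lintegral_enorm_lt_top_of_isCompact hE _⟩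
  -- Centring `k` at `f x` multiplies the potential by a constant, which the normalization removes.
  have hgibbs : ∀ x, (μstar x).toMeasure =
      boltzmannGibbs (interactionPotential lam k x) ν.toMeasure := fun x => by
    change ν.toMeasure.tilted (u x) = ν.toMeasure.tilted fun y => inner ℝ (lam x) (kv x y)
    exact (congrArg ν.toMeasure.tilted (funext fun y => inner_sub_right _ _ _)).trans
      (tilted_sub_const _ _ (inner ℝ (lam x) (fv x)))
  have hmem : ∀ x, μstar x ∈ constraintSet k f ν x := fun x => by
    refine ⟨tilted_absolutelyContinuous _ _, hkint x _, ?_⟩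
    have h1 := hHmean x (μstar x)
    rw [show ∫ y, H x y ∂(μstar x).toMeasure = 0 from
      integral_tilted_eq_zero (hHx x) (hHC x) (hlam x)] at h1
    exact (sub_eq_zero.1 h1.symm)
  have humean : ∀ x, ∀ γ ∈ constraintSet k f ν x, ∫ y, u x y ∂γ.toMeasure = 0 := by
    intro x γ hγ
    have := γ.isProb
    have hint : Integrable (H x) γ.toMeasure := (hkint x γ).sub (integrable_const _)
    rw [show ∫ y, u x y ∂γ.toMeasure = inner ℝ (lam x) (∫ y, H x y ∂γ.toMeasure) from
      integral_inner hint _, hHmean, show ∫ y, kv x y ∂γ.toMeasure = fv x from hγ.2.2, sub_self,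
      inner_zero_right]
  have hcompare : ∀ x, ∀ γ ∈ constraintSet k f ν x, _ := fun x γ hγ =>
    have := γ.isProb
    klDiv_tilted_le_and_eq_of_klDiv_le (ν := ν.toMeasure) (γ := γ.toMeasure) (hu x) (huC x)
      ((humean x γ hγ).trans (humean x _ (hmem x)).symm)
  have hmeas : ∀ A, MeasurableSet A → Measurable fun x => (μstar x).toMeasure A := fun A hA =>
    measurable_tilted_apply hH hHC hlam hA
  refine ⟨lam, μstar, hgibbs, fun x μ => ⟨fun hμ => ?_, ?_⟩, measurable_wassersteinOne hE hmeas,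
    ⟨fun x => (μstar x).toMeasure, Measure.measurable_of_measurable_coe _ hmeas⟩,
    ⟨fun x => (μstar x).isProb⟩, fun x => rfl, hgibbs⟩
  · exact WassersteinOne.ext ((hcompare x μ hμ.1).2
      (relEntropy_le_relEntropy_iff.1 (hμ.2 _ (hmem x))))
  · rintro rfl
    exact ⟨hmem x, fun γ hγ => relEntropy_le_relEntropy_iff.2 (hcompare x γ hγ).1⟩
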